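/- For $R>0$ let $\Gamma_R=\{\lambda\in\mathbb Z^2 : R-\tfrac1{\sqrt2}<\|\lambda\|<R+\tfrac1{\sqrt2}\}$, a finite nonempty set, and let $G=[-\tfrac1{\sqrt2},\tfrac1{\sqrt2}]\times[0,2\pi)$. Identifying $\mathbb R^2$ with $\mathbb C$, write each $\lambda\in\Gamma_R$ in shifted polar coordinates $\lambda=(R+r_\lambda)e^{i\theta_\lambda}$ with $R+r_\lambda=\|\lambda\|$ and $(r_\lambda,\theta_\lambda)\in G$ (with $\theta_\lambda:=0$ if $\lambda=0$, which can occur only for $R<\tfrac1{\sqrt2}$). Then, as $R\to\infty$ through the positive reals, the random vectors $(r_\lambda,\theta_\lambda)$, where $\lambda$ is drawn uniformly from $\Gamma_R$, converge in distribution to the uniform random vector on $G$, i.e. to the vector whose law is the probability measure $\frac{dr\,d\theta}{\sqrt8\,\pi}$ on $G$. -/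

import Mathlib

open MeasureTheory ProbabilityTheory Filter Topology

noncomputable section

namespace CircleLattice

/-- The lattice point `p ∈ ℤ²`, seen in `ℂ ≅ ℝ²`. -/
def toC (p : ℤ × ℤ) : ℂ := ⟨(p.1 : ℝ), (p.2 : ℝ)⟩

/-- The set `Γ_R` of the lattice points in the open annulus
`{z : R - 1/√2 < ‖z‖ < R + 1/√2}`. -/
def annulusPoints (R : ℝ) : Set (ℤ × ℤ) :=
  {p | R - 1 / √2 < ‖toC p‖ ∧ ‖toC p‖ < R + 1 / √2}

/-- The rectangle `G = [-1/√2, 1/√2] × [0, 2π)`. -/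
def rectG : Set (ℝ × ℝ) :=
  Set.Icc (-(1 / √2)) (1 / √2) ×ˢ Set.Ico 0 (2 * Real.pi)

/-- The shifted polar coordinates `(r, θ)` of a lattice point: `r` is the modulus minus `R`, and
`θ` is the representative in `[0, 2π)` of the argument. -/
def shiftedPolar (R : ℝ) (p : ℤ × ℤ) : ℝ × ℝ :=
  (‖toC p‖ - R, toIcoMod Real.two_pi_pos 0 (toC p).arg)

/-- The probability measure `dr dθ / (√8 π)` on `G`, as a measure on `ℝ × ℝ`. -/
def unifG : Measure (ℝ × ℝ) :=
  ENNReal.ofReal (1 / (√8 * Real.pi)) • (volume : Measure (ℝ × ℝ)).restrict rectG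

/-- The shifted polar coordinates of a point of `Γ_R` lie in `G`. -/
theorem shiftedPolar_mem {R : ℝ} {p : ℤ × ℤ} (hp : p ∈ annulusPoints R) :
    shiftedPolar R p ∈ rectG := by
  obtain ⟨h1, h2⟩ := hp
  refine ⟨⟨?_, ?_⟩, ?_⟩
  · simp only [shiftedPolar]; linarith
  · simp only [shiftedPolar]; linarith
  · simpa [shiftedPolar] using toIcoMod_mem_Ico Real.two_pi_pos 0 (toC p).arg

/-- The defining relation `λ = (R + r) e^{iθ}` of the shifted polar coordinates. -/
theorem shiftedPolar_spec (R : ℝ) (p : ℤ × ℤ) :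
    toC p = ((R + (shiftedPolar R p).1 : ℝ) : ℂ) *
      Complex.exp (((shiftedPolar R p).2 : ℂ) * Complex.I) := by
  have h : Complex.exp (((shiftedPolar R p).2 : ℂ) * Complex.I) =
      Complex.exp (((toC p).arg : ℂ) * Complex.I) := by
    rw [Complex.exp_eq_exp_iff_exists_int]
    refine ⟨-toIcoDiv Real.two_pi_pos 0 (toC p).arg, ?_⟩
    simp only [shiftedPolar, toIcoMod]
    push_cast [zsmul_eq_mul]
    ring
  rw [h]
  have h2 : R + (shiftedPolar R p).1 = ‖toC p‖ := by simp [shiftedPolar]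
  rw [h2, Complex.norm_mul_exp_arg_mul_I]

theorem annulusPoints_finite (R : ℝ) : (annulusPoints R).Finite := by
  obtain ⟨N, hN⟩ := exists_nat_gt (R + 1 / √2)
  refine ((Set.finite_Icc (-(N : ℤ)) N).prod (Set.finite_Icc (-(N : ℤ)) N)).subset ?_
  rintro p ⟨-, h⟩
  have a := abs_le.1 ((Complex.abs_re_le_norm (toC p)).trans (h.trans hN).le)
  have b := abs_le.1 ((Complex.abs_im_le_norm (toC p)).trans (h.trans hN).le)
  simp only [toC] at a b
  exact ⟨⟨by exact_mod_cast a.1, by exact_mod_cast a.2⟩,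
    ⟨by exact_mod_cast b.1, by exact_mod_cast b.2⟩⟩

theorem annulusPoints_nonempty {R : ℝ} (hR : 0 < R) : (annulusPoints R).Nonempty := by
  have hs : (1 : ℝ) / 2 < 1 / √2 :=
    one_div_lt_one_div_of_lt (by positivity)
      (by rw [Real.sqrt_lt' (by norm_num)]; norm_num)
  refine ⟨(round R, 0), ?_⟩
  have hr := abs_le.1 (abs_sub_round R)
  have h0 : (0 : ℝ) ≤ (round R : ℝ) := by
    have : (-1 : ℝ) < (round R : ℝ) := by linarith [hr.2]
    have h' : (-1 : ℤ) < round R := by exact_mod_cast this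
    exact_mod_cast (by omega : (0 : ℤ) ≤ round R)
  have hn : ‖toC (round R, 0)‖ = (round R : ℝ) := by
    have : toC (round R, 0) = ((round R : ℝ) : ℂ) := by
      apply Complex.ext <;> simp [toC]
    rw [this, Complex.norm_real, Real.norm_of_nonneg h0]
  exact ⟨by rw [hn]; linarith [hr.2], by rw [hn]; linarith [hr.1]⟩

theorem volume_rectG : volume rectG = ENNReal.ofReal (√8 * Real.pi) := by
  have h2 : √2 * √2 = (2 : ℝ) := Real.mul_self_sqrt (by norm_num)
  have h8 : √8 = 2 * √2 := by
    rw [show (8 : ℝ) = 2 ^ 2 * 2 by norm_num, Real.sqrt_mul (by norm_num),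
      Real.sqrt_sq (by norm_num)]
  have hp : (0 : ℝ) < √2 := by positivity
  rw [rectG, Measure.volume_eq_prod, Measure.prod_prod, Real.volume_Icc, Real.volume_Ico,
    ← ENNReal.ofReal_mul (by have : 0 < 1 / √2 := by positivity
                             linarith)]
  congr 1
  rw [h8]
  field_simp
  rw [pow_two, h2]
  ring

/-- `unifG` is the normalised Lebesgue measure of `G`. -/
theorem unifG_eq_cond : unifG = cond volume rectG := by
  rw [unifG, ProbabilityTheory.cond, volume_rectG, one_div,
    ENNReal.ofReal_inv_of_pos (by positivity)]

instance isProbabilityMeasure_unifG : IsProbabilityMeasure unifG := by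
  have hpos : (0 : ℝ) < √8 * Real.pi := by positivity
  rw [unifG_eq_cond]
  exact cond_isProbabilityMeasure_of_finite
    (by rw [volume_rectG]; simpa using hpos) (by rw [volume_rectG]; exact ENNReal.ofReal_ne_top)

instance isProbabilityMeasure_annulus (R : {R : ℝ // 0 < R}) : IsProbabilityMeasure (uniformOn (annulusPoints R)) :=
  isProbabilityMeasure_uniformOn (annulusPoints_finite R) (annulusPoints_nonempty R.2)

end CircleLattice

end

namespace CircleLattice

/-! Fix a radial interval `(a, b)` and count lattice points with `‖λ‖ - R` in it and angle in a
window. Comparing with the area of unit cells only gives the count up to a boundary error of the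
same order `R` as the main term, since the annulus has bounded width.

The error is removed near a direction `θ` with `cot θ` irrational. There the numbers `p cos θ + q
sin θ` are dense in `ℝ`, so translation by a suitable lattice vector moves a narrow sector radially
by nearly any prescribed amount `τ`. Hence the thin sector can be compared with each of `n` adjacent
tiles, whose union has radial length about `n (b - a)`; over this length the area error is a
fraction `O(1 / n)`. This is the content of `exists_eventually_sectorCount_le` and
`exists_eventually_le_sectorCount`.

To integrate over angles, take limits of the counts divided by `R` along an ultrafilter. The limit
`g t` for angles in `[0, t)` is Lipschitz by the crude bound and has derivative `b - a` off the
countable set of rational slopes, so `g t = (b - a) t` (`eq_of_ultrafilter_limit`). Ratios of such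
counts give convergence on a π-system of rectangles, hence in distribution. -/

/-! ### Unit cells: counting by area -/

/-- The lattice point whose unit cell contains `z`. -/
noncomputable def cellPoint (z : ℂ) : ℤ × ℤ := (⌊z.re⌋, ⌊z.im⌋)

theorem measurable_cellPoint : Measurable cellPoint :=
  (Int.measurable_floor.comp Complex.measurable_re).prodMk
    (Int.measurable_floor.comp Complex.measurable_im)

theorem volume_preimage_cellPoint_singleton (p : ℤ × ℤ) : volume (cellPoint ⁻¹' {p}) = 1 := by
  have h : cellPoint ⁻¹' {p} = Complex.measurableEquivRealProd ⁻¹'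
      (Set.Ico (p.1 : ℝ) (p.1 + 1) ×ˢ Set.Ico (p.2 : ℝ) (p.2 + 1)) := by
    ext z
    simp [cellPoint, Prod.ext_iff, Int.floor_eq_iff]
  rw [h, Complex.volume_preserving_equiv_real_prod.measure_preimage
    (measurableSet_Ico.prod measurableSet_Ico).nullMeasurableSet, Measure.volume_eq_prod,
    Measure.prod_prod]
  simp

/-- Unit cells have area one, so `cellPoint` pushes Lebesgue measure to counting measure. -/
theorem volume_preimage_cellPoint (P : Set (ℤ × ℤ)) :
    volume (cellPoint ⁻¹' P) = Measure.count P := by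
  have h : Measure.map cellPoint volume = Measure.count := by
    refine Measure.ext_of_singleton fun p => ?_
    rw [Measure.map_apply measurable_cellPoint (measurableSet_singleton p),
      volume_preimage_cellPoint_singleton, Measure.count_singleton]
  rw [← h, Measure.map_apply measurable_cellPoint (Set.to_countable P).measurableSet]

theorem volume_real_preimage_cellPoint {P : Set (ℤ × ℤ)} (hP : P.Finite) :
    volume.real (cellPoint ⁻¹' P) = P.ncard := by
  rw [measureReal_def, volume_preimage_cellPoint, Measure.count_apply_finite _ hP,
    Set.ncard_eq_toFinset_card P hP]
  simp

theorem norm_sub_cellPoint_le (z : ℂ) : ‖z - toC (cellPoint z)‖ ≤ 2 := by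
  refine (Complex.norm_le_abs_re_add_abs_im _).trans ?_
  have h1 := Int.floor_le z.re
  have h2 := Int.lt_floor_add_one z.re
  have h3 := Int.floor_le z.im
  have h4 := Int.lt_floor_add_one z.im
  have h5 : |(z - toC (cellPoint z)).re| ≤ 1 := by
    simp only [toC, cellPoint, Complex.sub_re]
    rw [abs_le]; constructor <;> linarith
  have h6 : |(z - toC (cellPoint z)).im| ≤ 1 := by
    simp only [toC, cellPoint, Complex.sub_im]
    rw [abs_le]; constructor <;> linarith
  linarith

/-! ### Sectors and their area -/

/-- The part of the plane with shifted modulus in `I` and argument relative to `conj u` in `J`. -/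
def sector (u : ℂ) (R : ℝ) (I J : Set ℝ) : Set ℂ :=
  {z | ‖z‖ - R ∈ I ∧ (z * u).arg ∈ J}

/-- The number of lattice points in a sector. -/
noncomputable def sectorCount (u : ℂ) (R : ℝ) (I J : Set ℝ) : ℝ :=
  ((toC ⁻¹' sector u R I J).ncard : ℝ)

theorem sector_mono {u : ℂ} {R : ℝ} {I I' J J' : Set ℝ} (hI : I ⊆ I') (hJ : J ⊆ J') :
    sector u R I J ⊆ sector u R I' J' :=
  fun _ h => ⟨hI h.1, hJ h.2⟩

theorem finite_norm_le (C : ℝ) : {p : ℤ × ℤ | ‖toC p‖ ≤ C}.Finite := by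
  obtain ⟨N, hN⟩ := exists_nat_gt C
  refine ((Set.finite_Icc (-(N : ℤ)) N).prod (Set.finite_Icc (-(N : ℤ)) N)).subset ?_
  intro p (h : ‖toC p‖ ≤ C)
  have a := abs_le.1 ((Complex.abs_re_le_norm (toC p)).trans (h.trans hN.le))
  have b := abs_le.1 ((Complex.abs_im_le_norm (toC p)).trans (h.trans hN.le))
  simp only [toC] at a b
  exact ⟨⟨by exact_mod_cast a.1, by exact_mod_cast a.2⟩,
    ⟨by exact_mod_cast b.1, by exact_mod_cast b.2⟩⟩

theorem measurableSet_sector {u : ℂ} {R : ℝ} {I J : Set ℝ} (hI : MeasurableSet I)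
    (hJ : MeasurableSet J) : MeasurableSet (sector u R I J) :=
  (measurableSet_preimage (by fun_prop : Measurable fun z : ℂ => ‖z‖ - R) hI).inter
    (measurableSet_preimage
      (Complex.measurable_arg.comp (measurable_id.mul_const u)) hJ)

theorem volume_real_sector_one {R c d : ℝ} (hc : 0 < R + c) (hcd : c ≤ d) {J : Set ℝ}
    (hJ : MeasurableSet J) :
    volume.real (sector 1 R (Set.Icc c d) J) =
      ((R + d) ^ 2 - (R + c) ^ 2) / 2 * volume.real (J ∩ Set.Ioo (-Real.pi) Real.pi) := by
  have hm := measurableSet_sector (u := 1) (R := R) (measurableSet_Icc (a := c) (b := d)) hJ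
  have h := Complex.integral_comp_polarCoord_symm
    (Set.indicator (sector 1 R (Set.Icc c d) J) (1 : ℂ → ℝ))
  rw [integral_indicator_one hm] at h
  rw [← h]
  have hset : ∀ p ∈ polarCoord.target,
      p.1 • Set.indicator (sector 1 R (Set.Icc c d) J) (1 : ℂ → ℝ) (Complex.polarCoord.symm p) =
      Set.indicator (Set.Icc (R + c) (R + d) ×ˢ (J ∩ Set.Ioo (-Real.pi) Real.pi))
        (fun p : ℝ × ℝ => p.1 * 1) p := by
    rintro ⟨r, t⟩ hp
    have hp' : 0 < r ∧ t ∈ Set.Ioo (-Real.pi) Real.pi := hp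
    have harg : (Complex.polarCoord.symm (r, t)).arg = t := by
      rw [Complex.polarCoord_symm_apply]
      simpa using Complex.arg_mul_cos_add_sin_mul_I hp'.1 ⟨hp'.2.1, hp'.2.2.le⟩
    have hn : ‖Complex.polarCoord.symm (r, t)‖ = r := by
      rw [Complex.norm_polarCoord_symm, abs_of_pos hp'.1]
    have hiff : Complex.polarCoord.symm (r, t) ∈ sector 1 R (Set.Icc c d) J ↔
        (r, t) ∈ Set.Icc (R + c) (R + d) ×ˢ (J ∩ Set.Ioo (-Real.pi) Real.pi) := by
      simp only [sector, Set.mem_ofPred_eq, mul_one, harg, hn, Set.mem_prod, Set.mem_inter_iff, hp'.2,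
        and_true, Set.mem_Icc]
      constructor <;> rintro ⟨⟨h1, h2⟩, h3⟩ <;> exact ⟨⟨by linarith, by linarith⟩, h3⟩
    by_cases hz : (r, t) ∈ Set.Icc (R + c) (R + d) ×ˢ (J ∩ Set.Ioo (-Real.pi) Real.pi)
    · rw [Set.indicator_of_mem (hiff.2 hz), Set.indicator_of_mem hz]; simp
    · rw [Set.indicator_of_notMem (fun h => hz (hiff.1 h)), Set.indicator_of_notMem hz]; simp
  rw [setIntegral_congr_fun polarCoord.open_target.measurableSet hset,
    setIntegral_indicator (measurableSet_Icc.prod (hJ.inter measurableSet_Ioo)),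
    Set.inter_eq_self_of_subset_right, Measure.volume_eq_prod,
    setIntegral_prod_mul (fun x : ℝ => x) (fun _ : ℝ => (1 : ℝ)), integral_Icc_eq_integral_Ioc,
    ← intervalIntegral.integral_of_le (by linarith), integral_id]
  · simp
  · rintro ⟨r, t⟩ ⟨h1, h2⟩
    exact ⟨lt_of_lt_of_le hc h1.1, h2.2⟩

theorem volume_real_sector {u : ℂ} (hu : ‖u‖ = 1) {R c d : ℝ} (hc : 0 < R + c) (hcd : c ≤ d)
    {J : Set ℝ} (hJ : MeasurableSet J) :
    volume.real (sector u R (Set.Icc c d) J) =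
      ((R + d) ^ 2 - (R + c) ^ 2) / 2 * volume.real (J ∩ Set.Ioo (-Real.pi) Real.pi) := by
  rw [← volume_real_sector_one hc hcd hJ]
  have hmp := (rotation ⟨u, mem_sphere_zero_iff_norm.2 hu⟩).measurePreserving
  rw [measureReal_def, measureReal_def, ← hmp.measure_preimage
    (s := sector 1 R (Set.Icc c d) J) (measurableSet_sector measurableSet_Icc hJ).nullMeasurableSet]
  congr 2
  ext z
  have h : rotation ⟨u, mem_sphere_zero_iff_norm.2 hu⟩ z = z * u := mul_comm u z
  simp [sector, h]

/-! ### Effect of a translation on argument and modulus -/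

/-- A bounded displacement changes the argument of a far away point by little. -/
theorem eventually_arg_perturb (K V : ℝ) {η : ℝ} (hη : 0 < η) :
    ∀ᶠ R : ℝ in atTop, ∀ u z v : ℂ, ‖u‖ = 1 → ‖v‖ ≤ V → -K ≤ ‖z‖ - R → |(z * u).arg| ≤ 2 →
      |((z + v) * u).arg - (z * u).arg| < η := by
  have hcont : ContinuousAt Complex.arg 1 := Complex.continuousAt_arg Complex.one_mem_slitPlane
  obtain ⟨ρ, hρ, hball⟩ := Metric.continuousAt_iff.1 hcont (min η 1) (lt_min hη one_pos)
  filter_upwards [eventually_gt_atTop (K + (|V| + 1) / ρ), eventually_gt_atTop (K + |V|)]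
    with R hR hRK
  intro u z v hu hv hz harg
  have hzpos : (|V| + 1) / ρ < ‖z‖ := by linarith
  have hz0 : 0 < ‖z‖ := lt_of_le_of_lt (by positivity) hzpos
  have hz0' : z ≠ 0 := norm_pos_iff.1 hz0
  have hu0 : u ≠ 0 := norm_pos_iff.1 (by rw [hu]; exact one_pos)
  have hw : ‖v / z‖ < ρ := by
    rw [norm_div, div_lt_iff₀ hz0]
    rw [div_lt_iff₀ hρ] at hzpos
    nlinarith [le_abs_self V]
  have h1 := hball (x := 1 + v / z) (by simpa [dist_eq_norm] using hw)
  rw [Complex.arg_one, Real.dist_0_eq_abs] at h1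
  have hw0 : 1 + v / z ≠ 0 := by
    intro h0
    have h2 : z + v = 0 := by
      have : z + v = z * (1 + v / z) := by field_simp
      rw [this, h0, mul_zero]
    rw [eq_neg_of_add_eq_zero_left h2, norm_neg] at hz
    linarith [le_abs_self V]
  have heq : (z + v) * u = (z * u) * (1 + v / z) := by field_simp
  have hpi := Real.pi_gt_three
  have h2 := abs_lt.1 (lt_of_lt_of_le h1 (min_le_right _ _))
  have h3 := abs_le.1 harg
  -- The two arguments are at most 2 and 1 in absolute value; their sum stays below `π`, so
  -- arguments add without wrapping.
  rw [heq, Complex.arg_mul (mul_ne_zero hz0' hu0) hw0 ⟨by linarith [h2.1], by linarith [h2.2]⟩,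
    add_sub_cancel_left]
  exact lt_of_lt_of_le h1 (min_le_left _ _)

/-- First-order expansion of the modulus at a point of the positive real axis: only the radial
component of the displacement matters. -/
theorem abs_norm_add_sub_le {ρ : ℝ} {q : ℂ} (hρ : 0 < ρ) (hq : 2 * ‖q‖ ≤ ρ) :
    |‖(ρ : ℂ) + q‖ - ρ - q.re| ≤ ‖q‖ ^ 2 / ρ := by
  have hre := abs_le.1 (Complex.abs_re_le_norm q)
  have hn := norm_nonneg q
  rw [abs_le]
  constructor
  · have := Complex.re_le_norm ((ρ : ℂ) + q)
    simp only [Complex.add_re, Complex.ofReal_re] at this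
    have : 0 ≤ ‖q‖ ^ 2 / ρ := by positivity
    linarith
  · have hs : 0 ≤ ‖q‖ ^ 2 / ρ := by positivity
    have h : ‖(ρ : ℂ) + q‖ ≤ ρ + q.re + ‖q‖ ^ 2 / ρ := by
      refine le_of_sq_le_sq ?_ (by linarith)
      have e1 : ‖(ρ : ℂ) + q‖ ^ 2 = ρ ^ 2 + 2 * ρ * q.re + ‖q‖ ^ 2 := by
        rw [Complex.sq_norm, Complex.sq_norm, Complex.normSq_apply, Complex.normSq_apply]
        simp; ring
      have e2 : ‖q‖ ^ 2 / ρ * ρ = ‖q‖ ^ 2 := by field_simp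
      rw [e1]
      nlinarith [sq_nonneg q.re, mul_nonneg hs (by linarith : 0 ≤ ρ + 2 * q.re), sq_nonneg (‖q‖ ^ 2 / ρ)]
    linarith

/-- Rotating `z` onto the positive real axis reduces to `abs_norm_add_sub_le`. The three errors `η`
come from the second-order term, from the angle between `z` and `conj u`, and from replacing `(v *
u).re` by `τ`. -/
theorem abs_norm_add_sub_sub_le {u z v : ℂ} {δ η τ : ℝ} (hu : ‖u‖ = 1) (hz : 0 < ‖z‖)
    (hvz : 2 * ‖v‖ ≤ ‖z‖) (hvη : ‖v‖ ^ 2 / ‖z‖ ≤ η) (harg : |(z * u).arg| ≤ δ)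
    (hδ : δ * ‖v‖ ≤ η) (hτ : |(v * u).re - τ| ≤ η) : |‖z + v‖ - ‖z‖ - τ| ≤ 3 * η := by
  set ψ := (z * u).arg
  set e : ℂ := Complex.exp (Complex.I * (-ψ : ℝ))
  have he : ‖e‖ = 1 := by simp [e, Complex.norm_exp]
  have hzu : z * u * e = (‖z‖ : ℂ) := by
    have h := Complex.norm_mul_exp_arg_mul_I (z * u)
    rw [norm_mul, hu, mul_one] at h
    rw [← h, mul_assoc, ← Complex.exp_add]
    simp [ψ, mul_comm]
  have hsum : ‖z + v‖ = ‖(‖z‖ : ℂ) + v * u * e‖ := by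
    rw [← hzu, ← add_mul, ← add_mul, norm_mul, norm_mul, hu, he, mul_one, mul_one]
  have hq : ‖v * u * e‖ = ‖v‖ := by rw [norm_mul, norm_mul, hu, he, mul_one, mul_one]
  have h1 := abs_norm_add_sub_le (q := v * u * e) hz (by rwa [hq])
  rw [hq, ← hsum] at h1
  have h2 : |(v * u * e).re - (v * u).re| ≤ η := by
    rw [← Complex.sub_re]
    refine (Complex.abs_re_le_norm _).trans ?_
    have h3 : v * u * e - v * u = v * u * (e - 1) := by ring
    have h4 : ‖e - 1‖ ≤ |ψ| := by
      simpa [e] using Real.norm_exp_I_mul_ofReal_sub_one_le (x := -ψ)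
    rw [h3, norm_mul, norm_mul, hu, mul_one]
    nlinarith [norm_nonneg v]
  have := abs_le.1 (h1.trans hvη)
  have := abs_le.1 h2
  have := abs_le.1 hτ
  rw [abs_le]
  constructor <;> linarith

/-! ### Crude counts from area -/

theorem finite_preimage_sector (u : ℂ) (R : ℝ) {I J : Set ℝ} (hI : BddAbove I) :
    (toC ⁻¹' sector u R I J).Finite := by
  obtain ⟨C, hC⟩ := hI
  refine (finite_norm_le (C + R)).subset fun p hp => ?_
  have := hC hp.1
  change ‖toC p‖ ≤ C + R
  linarith

theorem volume_sector_ne_top (u : ℂ) (R : ℝ) {I J : Set ℝ} (hI : BddAbove I) :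
    volume (sector u R I J) ≠ ⊤ := by
  obtain ⟨C, hC⟩ := hI
  refine ((measure_mono fun z hz => ?_).trans_lt
    (measure_closedBall_lt_top (x := (0 : ℂ)) (r := C + R))).ne
  have := hC hz.1
  rw [mem_closedBall_zero_iff]
  linarith

theorem sectorCount_mono {u : ℂ} {R : ℝ} {I I' J J' : Set ℝ} (hI : I ⊆ I') (hJ : J ⊆ J')
    (hI' : BddAbove I') : sectorCount u R I J ≤ sectorCount u R I' J' := by
  unfold sectorCount
  exact_mod_cast Set.ncard_le_ncard (Set.preimage_mono (sector_mono hI hJ))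
    (finite_preimage_sector u R hI')

/-- The cells of the counted points reach at most 2 beyond the sector on either radial side, whence
the 4; their angular overhang vanishes as `R` grows. -/
theorem eventually_sectorCount_le {u : ℂ} (hu : ‖u‖ = 1) {c d s t ε : ℝ} (hcd : c ≤ d)
    (hs : -1 ≤ s) (hst : s ≤ t) (ht : t ≤ 1) (hε : 0 < ε) :
    ∀ᶠ R : ℝ in atTop,
      sectorCount u R (Set.Icc c d) (Set.Icc s t) ≤ ((d - c + 4) * (t - s) + ε) * R := by
  have hA : 0 < d - c + 4 := by linarith
  set A := d - c + 4 with hAdef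
  set η := min 1 (ε / (4 * A))
  have hη : 0 < η := lt_min one_pos (by positivity)
  have hη1 : η ≤ 1 := min_le_left _ _
  have hηA : 2 * η * A ≤ ε / 2 := by
    have : η * (4 * A) ≤ ε := (le_div_iff₀ (by positivity)).1 (min_le_right _ _)
    linarith
  set B := A * ((c + d) / 2) * (t - s + 2 * η) with hB
  filter_upwards [eventually_arg_perturb (-c) 2 hη, eventually_gt_atTop (2 - c),
    eventually_ge_atTop (2 * |B| / ε), eventually_gt_atTop (2 - d)] with R hR hRc hRB hRd
  have hsub : cellPoint ⁻¹' (toC ⁻¹' sector u R (Set.Icc c d) (Set.Icc s t)) ⊆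
      sector u R (Set.Icc (c - 2) (d + 2)) (Set.Icc (s - η) (t + η)) := by
    rintro z ⟨⟨h1, h2⟩, h3, h4⟩
    have hv := norm_sub_cellPoint_le z
    have h5 := abs_lt.1 (hR u (toC (cellPoint z)) (z - toC (cellPoint z)) hu hv (by linarith)
      (abs_le.2 ⟨by linarith, by linarith⟩))
    rw [add_sub_cancel] at h5
    have h6 := abs_le.1 ((abs_norm_sub_norm_le z (toC (cellPoint z))).trans hv)
    exact ⟨⟨by linarith, by linarith⟩, ⟨by linarith, by linarith⟩⟩
  have hvol := measureReal_mono hsub (volume_sector_ne_top u R bddAbove_Icc)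
  rw [volume_real_preimage_cellPoint (finite_preimage_sector u R bddAbove_Icc),
    volume_real_sector hu (by linarith) (by linarith) measurableSet_Icc] at hvol
  have hint : volume.real (Set.Icc (s - η) (t + η) ∩ Set.Ioo (-Real.pi) Real.pi) ≤
      t - s + 2 * η := by
    refine (measureReal_mono Set.inter_subset_left (by simp)).trans ?_
    rw [Real.volume_real_Icc_of_le (by linarith)]
    linarith
  have hfac : ((R + (d + 2)) ^ 2 - (R + (c - 2)) ^ 2) / 2 = A * (R + (c + d) / 2) := by
    rw [hAdef]; ring
  rw [hfac] at hvol
  refine hvol.trans ((mul_le_mul_of_nonneg_left hint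
    (mul_nonneg hA.le (by linarith))).trans ?_)
  have hRB' : |B| ≤ ε / 2 * R := by
    rw [div_le_iff₀ hε] at hRB; linarith
  have e1 : A * (R + (c + d) / 2) * (t - s + 2 * η) =
      A * (t - s) * R + 2 * η * A * R + B := by rw [hB]; ring
  have hR0 : 0 ≤ R := by nlinarith [abs_nonneg B]
  rw [e1]
  nlinarith [le_abs_self B, mul_le_mul_of_nonneg_right hηA hR0]

theorem eventually_le_sectorCount {u : ℂ} (hu : ‖u‖ = 1) {c d s t ε : ℝ}
    (hs : -1 ≤ s) (hst : s < t) (ht : t ≤ 1) (hε : 0 < ε) :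
    ∀ᶠ R : ℝ in atTop,
      ((d - c - 6) * (t - s) - ε) * R ≤ sectorCount u R (Set.Ioo c d) (Set.Ioo s t) := by
  rcases le_or_gt (d - c - 6) 0 with hA | hA
  · filter_upwards [eventually_ge_atTop 0] with R hR
    refine le_trans ?_ (Nat.cast_nonneg _)
    exact mul_nonpos_of_nonpos_of_nonneg (by nlinarith) hR
  set A := d - c - 6 with hAdef
  set η := min ((t - s) / 2) (ε / (4 * A))
  have hη : 0 < η := lt_min (by linarith) (by positivity)
  have hη1 : η ≤ (t - s) / 2 := min_le_left _ _
  have hηA : 2 * η * A ≤ ε / 2 := by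
    have : η * (4 * A) ≤ ε := (le_div_iff₀ (by positivity)).1 (min_le_right _ _)
    linarith
  set B := A * ((c + d) / 2) * (t - s - 2 * η) with hB
  filter_upwards [eventually_arg_perturb (-c - 3) 2 hη, eventually_gt_atTop (- c - 3),
    eventually_ge_atTop (2 * |B| / ε)] with R hR hRc hRB
  -- A radial margin of 3 rather than 2 makes the inequalities for the open interval strict.
  have hsub : sector u R (Set.Icc (c + 3) (d - 3)) (Set.Icc (s + η) (t - η)) ⊆
      cellPoint ⁻¹' (toC ⁻¹' sector u R (Set.Ioo c d) (Set.Ioo s t)) := by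
    rintro z ⟨⟨h1, h2⟩, h3, h4⟩
    have hv := norm_sub_cellPoint_le z
    rw [norm_sub_rev] at hv
    have h5 := abs_lt.1 (hR u z (toC (cellPoint z) - z) hu hv (by linarith)
      (abs_le.2 ⟨by linarith, by linarith⟩))
    rw [add_sub_cancel] at h5
    have h6 := abs_le.1 ((abs_norm_sub_norm_le (toC (cellPoint z)) z).trans hv)
    exact ⟨⟨by linarith, by linarith⟩, ⟨by linarith, by linarith⟩⟩
  have hfin := finite_preimage_sector u R (I := Set.Ioo c d) (J := Set.Ioo s t) bddAbove_Ioo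
  have hvol := measureReal_mono (μ := volume) hsub (by
    rw [volume_preimage_cellPoint]
    exact (Measure.count_apply_lt_top.2 hfin).ne)
  have hpi := Real.pi_gt_three
  rw [volume_real_preimage_cellPoint hfin,
    volume_real_sector hu (by linarith) (by linarith) measurableSet_Icc,
    Set.inter_eq_self_of_subset_left, Real.volume_real_Icc_of_le (by linarith)] at hvol
  · refine le_trans ?_ hvol
    have hRB' : |B| ≤ ε / 2 * R := by
      rw [div_le_iff₀ hε] at hRB; linarith
    have e1 : ((R + (d - 3)) ^ 2 - (R + (c + 3)) ^ 2) / 2 * (t - η - (s + η)) =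
        A * (t - s) * R - 2 * η * A * R + B := by rw [hB, hAdef]; ring
    have hR0 : 0 ≤ R := by nlinarith [abs_nonneg B]
    rw [e1]
    nlinarith [neg_abs_le B, mul_le_mul_of_nonneg_right hηA hR0]
  · intro x hx
    exact ⟨by linarith [hx.1], by linarith [hx.2]⟩

/-! ### Lattice shifts and radial tiling -/

/-- Adding `v` is injective on the lattice and moves the sector radially by `τ` up to `3 * η`; the
fourth `η` makes the target open. -/
theorem eventually_sectorCount_le_shift {u : ℂ} (hu : ‖u‖ = 1) {v : ℤ × ℤ} {τ η δ : ℝ}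
    (hη : 0 < η) (hτ : |(toC v * u).re - τ| ≤ η) (hδv : δ * ‖toC v‖ ≤ η) (hδ : δ ≤ 1)
    {c d s t η' : ℝ} (hs : -δ ≤ s) (ht : t ≤ δ) (hη' : 0 < η') :
    ∀ᶠ R : ℝ in atTop, sectorCount u R (Set.Icc c d) (Set.Icc s t) ≤
      sectorCount u R (Set.Ioo (c + τ - 4 * η) (d + τ + 4 * η)) (Set.Ioo (s - η') (t + η')) := by
  filter_upwards [eventually_arg_perturb (-c) ‖toC v‖ hη', eventually_gt_atTop (-c),
    eventually_ge_atTop (2 * ‖toC v‖ - c), eventually_ge_atTop (‖toC v‖ ^ 2 / η - c)]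
    with R hR h1 h2 h3
  unfold sectorCount
  refine Nat.cast_le.2 (Set.ncard_le_ncard_of_injOn (fun p => p + v) ?_
    (add_left_injective v).injOn (finite_preimage_sector u R bddAbove_Ioo))
  rintro p ⟨⟨ha, hb⟩, hc, hd⟩
  have hadd : toC (p + v) = toC p + toC v := by
    apply Complex.ext <;> simp [toC]
  have harg : |(toC p * u).arg| ≤ δ := abs_le.2 ⟨by linarith, by linarith⟩
  have h4 := abs_lt.1 (hR u (toC p) (toC v) hu le_rfl (by linarith) (by linarith))
  have hpos : 0 < ‖toC p‖ := by linarith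
  have h5 := abs_le.1 (abs_norm_add_sub_sub_le hu hpos (by linarith)
    (by rw [div_le_iff₀ hpos, ← div_le_iff₀' hη]; linarith) harg hδv hτ)
  refine ⟨⟨?_, ?_⟩, ?_, ?_⟩ <;> rw [hadd] <;> linarith

theorem sectorCount_Ico_add {u : ℂ} {R a b c : ℝ} (hab : a ≤ b) (hbc : b ≤ c) (J : Set ℝ) :
    sectorCount u R (Set.Ico a b) J + sectorCount u R (Set.Ico b c) J =
      sectorCount u R (Set.Ico a c) J := by
  unfold sectorCount
  rw [← Nat.cast_add, ← Set.ncard_union_eq _ (finite_preimage_sector u R bddAbove_Ico)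
    (finite_preimage_sector u R bddAbove_Ico), ← Set.preimage_union]
  · congr 3
    rw [← Set.Ico_union_Ico_eq_Ico hab hbc]
    ext z
    simp only [sector, Set.mem_union, Set.mem_ofPred_eq]
    tauto
  · rw [Set.disjoint_left]
    rintro p ⟨h1, -⟩ ⟨h2, -⟩
    exact absurd h1.2 (not_lt.2 h2.1)

theorem sum_sectorCount_tiles (u : ℂ) (R x : ℝ) {l : ℝ} (hl : 0 ≤ l) (J : Set ℝ) (n : ℕ) :
    ∑ k ∈ Finset.range n, sectorCount u R (Set.Ico (x + k * l) (x + (k + 1) * l)) J =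
      sectorCount u R (Set.Ico x (x + n * l)) J := by
  induction n with
  | zero => simp [sectorCount, sector]
  | succ n ih =>
    rw [Finset.sum_range_succ, ih, sectorCount_Ico_add]
    · push_cast; rfl
    · have : 0 ≤ n * l := by positivity
      linarith
    · nlinarith

/-- The projections of the lattice to the direction `conj u` are dense. -/
def DenseProjections (u : ℂ) : Prop :=
  ∀ τ η : ℝ, 0 < η → ∃ v : ℤ × ℤ, |(toC v * u).re - τ| ≤ η

/-- Finitely many shift vectors are bounded, so one angular radius `δ` serves them all. The cap `1 /
2` leaves room to widen windows within `[-1, 1]`. -/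
theorem DenseProjections.exists_shifts {u : ℂ} (h : DenseProjections u) (τ : ℕ → ℝ) {η : ℝ}
    (hη : 0 < η) (n : ℕ) : ∃ v : ℕ → ℤ × ℤ, ∃ δ : ℝ, 0 < δ ∧ δ ≤ 1 / 2 ∧ ∀ k ∈ Finset.range n,
      |(toC (v k) * u).re - τ k| ≤ η ∧ δ * ‖toC (v k)‖ ≤ η := by
  choose v hv using fun k => h (τ k) η hη
  set S := ∑ k ∈ Finset.range n, ‖toC (v k)‖ with hS
  have hS0 : 0 ≤ S := Finset.sum_nonneg fun _ _ => norm_nonneg _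
  have hpos : 0 < η / (1 + S) := by positivity
  refine ⟨v, min (1 / 2) (η / (1 + S)), lt_min (by norm_num) hpos, min_le_left _ _,
    fun k hk => ⟨hv k, ?_⟩⟩
  have h1 : ‖toC (v k)‖ ≤ 1 + S := by
    have := Finset.single_le_sum (f := fun k => ‖toC (v k)‖) (fun _ _ => norm_nonneg _) hk
    rw [hS]; linarith
  calc min (1 / 2) (η / (1 + S)) * ‖toC (v k)‖ ≤ η / (1 + S) * (1 + S) :=
        mul_le_mul (min_le_right _ _) h1 (norm_nonneg _) hpos.le
    _ = η := by field_simp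

/-- Shifted copies of the sector land in `n` disjoint tiles, so `n` times its count is at most the
crude count of their union. Since `δ` precedes `s` and `t`, the bound controls a derivative. -/
theorem exists_eventually_sectorCount_le {u : ℂ} (hu : ‖u‖ = 1) (hd : DenseProjections u)
    {a b ε : ℝ} (hab : a < b) (hε : 0 < ε) :
    ∃ δ > 0, ∀ s t : ℝ, -δ ≤ s → s < t → t ≤ δ → ∀ᶠ R : ℝ in atTop,
      sectorCount u R (Set.Ioo a b) (Set.Ico s t) ≤ (b - a + ε) * (t - s) * R := by
  set η := ε / 32 with hη
  have hη0 : 0 < η := by positivity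
  -- The tile length is the width of a shifted copy, widened by `4 * η` at both ends.
  set l := b - a + 8 * η with hl
  have hl0 : 0 < l := by linarith
  -- This makes the collar loss 4 at most `n * ε / 4`.
  obtain ⟨n, hn⟩ := exists_nat_gt (16 / ε)
  have hn0 : (0 : ℝ) < n := lt_trans (by positivity) hn
  rw [div_lt_iff₀ hε] at hn
  obtain ⟨v, δ, hδ, hδ1, hv⟩ := hd.exists_shifts (fun k => k * l) hη0 n
  refine ⟨δ, hδ, fun s t hs hst ht => ?_⟩
  set D := n * l + 4 with hD
  have hD0 : 0 < D := by positivity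
  set w := n * ε * (t - s) with hw
  have hw0 : 0 < w := by have := sub_pos.2 hst; positivity
  set η' := min (1 / 2) (w / (8 * D))
  have hη' : 0 < η' := lt_min (by norm_num) (by positivity)
  have hη'1 : η' ≤ 1 / 2 := min_le_left _ _
  have hη'D : η' * (8 * D) ≤ w := (le_div_iff₀ (by positivity)).1 (min_le_right _ _)
  have hshift : ∀ᶠ R : ℝ in atTop, ∀ k ∈ Finset.range n, _ :=
    (eventually_all_finset (Finset.range n)).2 fun k hk =>
      eventually_sectorCount_le_shift hu hη0 (hv k hk).1 (hv k hk).2 (by linarith)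
        (c := a) (d := b) hs ht hη'
  filter_upwards [hshift, eventually_ge_atTop 0,
    eventually_sectorCount_le hu (c := a - 4 * η) (d := a - 4 * η + n * l) (s := s - η')
      (t := t + η') (ε := w / 4) (by nlinarith) (by linarith) (by linarith) (by linarith)
      (by positivity)] with R hR hR0 hup
  have h1 : ∀ k ∈ Finset.range n, sectorCount u R (Set.Ioo a b) (Set.Ico s t) ≤
      sectorCount u R (Set.Ico (a - 4 * η + k * l) (a - 4 * η + (k + 1) * l))
        (Set.Icc (s - η') (t + η')) := by
    intro k hk
    refine (sectorCount_mono Set.Ioo_subset_Icc_self Set.Ico_subset_Icc_self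
      bddAbove_Icc).trans ((hR k hk).trans (sectorCount_mono ?_ Set.Ioo_subset_Icc_self
        bddAbove_Ico))
    refine Set.Ioo_subset_Ico_self.trans (Set.Ico_subset_Ico (by linarith) ?_)
    rw [hl]; linarith
  have h2 := Finset.sum_le_sum h1
  rw [sum_sectorCount_tiles u R _ hl0.le, Finset.sum_const, Finset.card_range,
    nsmul_eq_mul] at h2
  have h3 := h2.trans ((sectorCount_mono Set.Ico_subset_Icc_self subset_rfl
    bddAbove_Icc).trans hup)
  have e1 : a - 4 * η + n * l - (a - 4 * η) + 4 = D := by rw [hD]; ring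
  rw [e1] at h3
  have h4 : D * (t + η' - (s - η')) + w / 4 ≤ n * ((b - a + ε) * (t - s)) := by
    have h5 : D ≤ n * (b - a) + n * ε / 2 := by
      rw [hD, hl, hη]; nlinarith
    have h6 : D * (t - s) ≤ (n * (b - a) + n * ε / 2) * (t - s) :=
      mul_le_mul_of_nonneg_right h5 (by linarith)
    nlinarith
  have h7 := h3.trans (mul_le_mul_of_nonneg_right h4 hR0)
  rw [mul_assoc (n : ℝ)] at h7
  exact le_of_mul_le_mul_left h7 hn0

/-- The reverse comparison: `n` tiles slightly shorter than `b - a` are each shifted back into the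
thin sector. -/
theorem exists_eventually_le_sectorCount {u : ℂ} (hu : ‖u‖ = 1) (hd : DenseProjections u)
    {a b ε : ℝ} (hab : a < b) (hε : 0 < ε) :
    ∃ δ > 0, ∀ s t : ℝ, -δ ≤ s → s < t → t ≤ δ → ∀ᶠ R : ℝ in atTop,
      (b - a - ε) * (t - s) * R ≤ sectorCount u R (Set.Ioo a b) (Set.Ico s t) := by
  have hL : 0 < b - a := sub_pos.2 hab
  set η := min (ε / 32) ((b - a) / 16) with hη
  have hη0 : 0 < η := lt_min (by positivity) (by positivity)
  have hη1 : η ≤ ε / 32 := min_le_left _ _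
  have hη2 : η ≤ (b - a) / 16 := min_le_right _ _
  set l := b - a - 8 * η with hl
  have hl0 : 0 < l := by linarith
  obtain ⟨n, hn⟩ := exists_nat_gt (24 / ε)
  have hn0 : (0 : ℝ) < n := lt_trans (by positivity) hn
  rw [div_lt_iff₀ hε] at hn
  obtain ⟨v, δ, hδ, hδ1, hv⟩ := hd.exists_shifts (fun k => -(k * l)) hη0 n
  refine ⟨δ, hδ, fun s t hs hst ht => ?_⟩
  have hst' : 0 < t - s := sub_pos.2 hst
  set D := n * l - 6 with hD
  set η' := min ((t - s) / 4) (ε * (t - s) / (8 * (b - a)))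
  have hη' : 0 < η' := lt_min (by positivity) (by positivity)
  have hη'1 : η' ≤ (t - s) / 4 := min_le_left _ _
  have hη'D : η' * (8 * (b - a)) ≤ ε * (t - s) :=
    (le_div_iff₀ (by positivity)).1 (min_le_right _ _)
  have hshift : ∀ᶠ R : ℝ in atTop, ∀ k ∈ Finset.range n, _ :=
    (eventually_all_finset (Finset.range n)).2 fun k hk =>
      eventually_sectorCount_le_shift hu hη0 (hv k hk).1 (hv k hk).2 (by linarith)
        (c := a + 4 * η + k * l) (d := a + 4 * η + (k + 1) * l)
        (by linarith : -δ ≤ s + η') (by linarith : t - η' ≤ δ) hη'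
  filter_upwards [hshift, eventually_ge_atTop 0,
    eventually_le_sectorCount hu (c := a + 4 * η) (d := a + 4 * η + n * l) (s := s + η')
      (t := t - η') (ε := n * ε * (t - s) / 4) (by linarith) (by linarith) (by linarith)
      (by positivity)] with R hR hR0 hlow
  have h1 : ∀ k ∈ Finset.range n,
      sectorCount u R (Set.Ico (a + 4 * η + k * l) (a + 4 * η + (k + 1) * l))
        (Set.Ioo (s + η') (t - η')) ≤ sectorCount u R (Set.Ioo a b) (Set.Ico s t) := by
    intro k hk
    refine (sectorCount_mono Set.Ico_subset_Icc_self Set.Ioo_subset_Icc_self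
      bddAbove_Icc).trans ((hR k hk).trans (sectorCount_mono ?_ ?_ bddAbove_Ioo))
    · refine Set.Ioo_subset_Ioo (by linarith) ?_
      rw [hl]; linarith
    · rw [add_sub_cancel_right, sub_add_cancel]
      exact Set.Ioo_subset_Ico_self
  have h2 := Finset.sum_le_sum h1
  rw [sum_sectorCount_tiles u R _ hl0.le, Finset.sum_const, Finset.card_range,
    nsmul_eq_mul] at h2
  have h3 := (hlow.trans (sectorCount_mono Set.Ioo_subset_Ico_self subset_rfl
    bddAbove_Ico)).trans h2
  have e1 : a + 4 * η + n * l - (a + 4 * η) - 6 = D := by rw [hD]; ring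
  rw [e1] at h3
  have h4 : n * ((b - a - ε) * (t - s)) ≤
      D * (t - η' - (s + η')) - n * ε * (t - s) / 4 := by
    have h5 : n * (b - a) - n * ε / 2 ≤ D := by
      rw [hD, hl]; nlinarith
    have h6 : (n * (b - a) - n * ε / 2) * (t - s) ≤ D * (t - s) :=
      mul_le_mul_of_nonneg_right h5 hst'.le
    have h7 : D ≤ n * (b - a) := by rw [hD, hl]; nlinarith
    have h8 : D * η' ≤ n * (b - a) * η' := mul_le_mul_of_nonneg_right h7 hη'.le
    have h9 : n * (η' * (8 * (b - a))) ≤ n * (ε * (t - s)) :=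
      mul_le_mul_of_nonneg_left hη'D hn0.le
    nlinarith
  have h7 := (mul_le_mul_of_nonneg_right h4 hR0).trans h3
  rw [mul_assoc (n : ℝ)] at h7
  exact le_of_mul_le_mul_left h7 hn0

/-! ### Irrational directions -/

theorem denseProjections_of_irrational {θ : ℝ} (h : Irrational (Real.cos θ / Real.sin θ)) :
    DenseProjections (Complex.exp (-θ * Complex.I)) := by
  intro τ η hη
  obtain ⟨x, hx, hxτ⟩ := (dense_addSubgroupClosure_pair_iff.2 h).exists_dist_lt τ hη
  obtain ⟨p, q, rfl⟩ := AddSubgroup.mem_closure_pair.1 hx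
  refine ⟨(p, q), ?_⟩
  have he : (toC (p, q) * Complex.exp (-θ * Complex.I)).re = p * Real.cos θ + q * Real.sin θ := by
    rw [← Complex.ofReal_neg, Complex.exp_mul_I, ← Complex.ofReal_cos, ← Complex.ofReal_sin]
    simp [toC, Complex.cos_ofReal_re, Complex.sin_ofReal_re]
  rw [he, abs_sub_comm, ← Real.dist_eq]
  simpa using hxτ.le

theorem countable_rational_slopes :
    {θ : ℝ | ¬ Irrational (Real.cos θ / Real.sin θ)}.Countable := by
  have h : {θ : ℝ | ¬ Irrational (Real.cos θ / Real.sin θ)} ⊆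
      (⋃ q : ℚ, Set.range fun k : ℤ => (2 * k + 1) * Real.pi / 2 - Real.arctan q) ∪
        Set.range fun k : ℤ => (k : ℝ) * Real.pi := by
    intro θ hθ
    by_cases hs : Real.sin θ = 0
    -- Division by zero makes the quotient 0 here, so these angles belong to the exceptional set.
    · exact Or.inr (Real.sin_eq_zero_iff.1 hs)
    obtain ⟨q, hq⟩ := not_not.1 hθ
    refine Or.inl (Set.mem_iUnion.2 ⟨q, ?_⟩)
    have hc : Real.cos (θ + Real.arctan q) = 0 := by
      rw [Real.cos_add, Real.cos_arctan, Real.sin_arctan, (div_eq_iff hs).1 hq.symm]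
      ring
    obtain ⟨k, hk⟩ := Real.cos_eq_zero_iff.1 hc
    exact ⟨k, by simp only; linarith⟩
  exact ((Set.countable_iUnion fun _ => Set.countable_range _).union
    (Set.countable_range _)).mono h

/-! ### From sectors to shifted polar coordinates -/

theorem shiftedPolar_snd_mem_Ico_iff {R : ℝ} {p : ℤ × ℤ} (hp : toC p ≠ 0) {θ s t : ℝ}
    (hs0 : 0 ≤ s) (ht0 : t ≤ 2 * Real.pi) (hs : |s - θ| ≤ 1) (ht : |t - θ| ≤ 1) :
    (shiftedPolar R p).2 ∈ Set.Ico s t ↔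
      (toC p * Complex.exp (-θ * Complex.I)).arg ∈ Set.Ico (s - θ) (t - θ) := by
  have hpi := Real.pi_gt_three
  have hs' := abs_le.1 hs
  have ht' := abs_le.1 ht
  set φ := (shiftedPolar R p).2
  have hφmem : φ ∈ Set.Ico 0 (0 + 2 * Real.pi) := toIcoMod_mem_Ico Real.two_pi_pos 0 (toC p).arg
  have hn : 0 < ‖toC p‖ := norm_pos_iff.2 hp
  have hspec : toC p = ‖toC p‖ * Complex.exp (φ * Complex.I) := by
    have h := shiftedPolar_spec R p
    rwa [show R + (shiftedPolar R p).1 = ‖toC p‖ by simp [shiftedPolar]] at h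
  have hmul : toC p * Complex.exp (-θ * Complex.I) =
      ‖toC p‖ * Complex.exp ((φ - θ : ℝ) * Complex.I) := by
    conv_lhs => rw [hspec]
    rw [mul_assoc, ← Complex.exp_add]
    congr 2
    push_cast
    ring
  constructor
  · rintro ⟨h1, h2⟩
    have harg : (toC p * Complex.exp (-θ * Complex.I)).arg = φ - θ := by
      rw [hmul, Complex.exp_mul_I]
      exact Complex.arg_mul_cos_add_sin_mul_I hn ⟨by linarith, by linarith⟩
    rw [harg]
    exact ⟨by linarith, by linarith⟩
  · intro h
    set ψ := (toC p * Complex.exp (-θ * Complex.I)).arg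
    have h1 : toC p * Complex.exp (-θ * Complex.I) =
        ‖toC p‖ * Complex.exp (ψ * Complex.I) := by
      have h2 := Complex.norm_mul_exp_arg_mul_I (toC p * Complex.exp (-θ * Complex.I))
      have h3 : ‖toC p * Complex.exp (-θ * Complex.I)‖ = ‖toC p‖ := by
        rw [norm_mul, ← Complex.ofReal_neg, Complex.norm_exp_ofReal_mul_I, mul_one]
      rw [h3] at h2
      exact h2.symm
    rw [hmul] at h1
    obtain ⟨n, hn⟩ := Complex.exp_eq_exp_iff_exists_int.1
      (mul_left_cancel₀ (Complex.ofReal_ne_zero.2 hn.ne') h1)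
    have h3 : φ - θ = ψ + n * (2 * Real.pi) := by
      have := congrArg Complex.im hn
      simpa using this
    -- Both `φ` and `θ + ψ` lie in `[0, 2π)`, so they cannot differ by a nonzero multiple of `2π`.
    have hn0 : n = 0 := by
      have h4 : (-1 : ℝ) < n := by
        by_contra hc
        nlinarith [hφmem.1, h.2]
      have h5 : (n : ℝ) < 1 := by
        by_contra hc
        nlinarith [hφmem.2, h.1]
      have h4' : (-1 : ℤ) < n := by exact_mod_cast h4
      have h5' : n < 1 := by exact_mod_cast h5
      omega
    rw [hn0] at h3
    simp only [Int.cast_zero, zero_mul, add_zero] at h3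
    exact ⟨by linarith [h.1], by linarith [h.2]⟩

/-- The number of lattice points with shifted polar coordinates in `I × J`. -/
noncomputable def polarCount (R : ℝ) (I J : Set ℝ) : ℝ :=
  ((shiftedPolar R ⁻¹' (I ×ˢ J)).ncard : ℝ)

theorem finite_preimage_shiftedPolar (R : ℝ) {I J : Set ℝ} (hI : BddAbove I) :
    (shiftedPolar R ⁻¹' (I ×ˢ J)).Finite :=
  (finite_preimage_sector 1 R (J := Set.univ) hI).subset fun _ hp => ⟨hp.1, trivial⟩

theorem polarCount_Ico_add (R : ℝ) {I : Set ℝ} (hI : BddAbove I) {r s t : ℝ} (hrs : r ≤ s)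
    (hst : s ≤ t) : polarCount R I (Set.Ico r s) + polarCount R I (Set.Ico s t) =
      polarCount R I (Set.Ico r t) := by
  unfold polarCount
  rw [← Nat.cast_add, ← Set.ncard_union_eq _ (finite_preimage_shiftedPolar R hI)
    (finite_preimage_shiftedPolar R hI), ← Set.preimage_union, ← Set.prod_union,
    Set.Ico_union_Ico_eq_Ico hrs hst]
  rw [Set.disjoint_left]
  rintro p ⟨-, h1⟩ ⟨-, h2⟩
  exact absurd h1.2 (not_lt.2 h2.1)

theorem polarCount_eq_sectorCount {R : ℝ} {I : Set ℝ} (hI : ∀ x ∈ I, 0 < R + x) {θ s t : ℝ}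
    (hs0 : 0 ≤ s) (ht0 : t ≤ 2 * Real.pi) (hs : |s - θ| ≤ 1) (ht : |t - θ| ≤ 1) :
    polarCount R I (Set.Ico s t) =
      sectorCount (Complex.exp (-θ * Complex.I)) R I (Set.Ico (s - θ) (t - θ)) := by
  unfold polarCount sectorCount
  congr 2
  ext p
  refine and_congr_right fun h => ?_
  have hp : toC p ≠ 0 := by
    rw [← norm_pos_iff]
    have := hI _ h
    simpa [shiftedPolar] using this
  exact shiftedPolar_snd_mem_Ico_iff hp hs0 ht0 hs ht

theorem norm_exp_neg_mul_I (θ : ℝ) : ‖Complex.exp (-θ * Complex.I)‖ = 1 := by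
  rw [← Complex.ofReal_neg, Complex.norm_exp_ofReal_mul_I]

/-- Valid in every direction, rational or not; it yields the Lipschitz bound for limiting counts.
The slack is taken as `ε = t - s`, turning 4 into 5. -/
theorem eventually_polarCount_le {a b s t : ℝ} (hab : a < b) (hs : 0 ≤ s) (hst : s < t)
    (hst1 : t ≤ s + 1) (ht : t ≤ 2 * Real.pi) :
    ∀ᶠ R : ℝ in atTop, polarCount R (Set.Ioo a b) (Set.Ico s t) ≤ (b - a + 5) * (t - s) * R := by
  filter_upwards [eventually_gt_atTop (-a), eventually_sectorCount_le (norm_exp_neg_mul_I s)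
    hab.le (s := 0) (t := t - s) (by norm_num) (by linarith) (by linarith)
    (sub_pos.2 hst)] with R hR h
  rw [polarCount_eq_sectorCount (θ := s) (fun x hx => by linarith [hx.1]) hs ht (by simp)
    (abs_le.2 ⟨by linarith, by linarith⟩), sub_self]
  refine (sectorCount_mono Set.Ioo_subset_Icc_self Set.Ico_subset_Icc_self
    bddAbove_Icc).trans (h.trans (le_of_eq ?_))
  ring

theorem eventually_polarCount_div_mem {a b : ℝ} (hab : a ≤ b) (J : Set ℝ) :
    ∀ᶠ R : ℝ in atTop, polarCount R (Set.Ioo a b) J / R ∈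
      Set.Icc 0 ((b - a + 4) * (2 * Real.pi) * 2) := by
  filter_upwards [eventually_gt_atTop (2 - a), eventually_gt_atTop 0,
    eventually_ge_atTop ((a + b) / 2)] with R hR hR0 hRab
  refine ⟨div_nonneg (Nat.cast_nonneg _) hR0.le, ?_⟩
  rw [div_le_iff₀ hR0]
  have hfin := finite_preimage_shiftedPolar R (I := Set.Ioo a b) (J := J) bddAbove_Ioo
  have hsub : cellPoint ⁻¹' (shiftedPolar R ⁻¹' (Set.Ioo a b ×ˢ J)) ⊆
      sector 1 R (Set.Icc (a - 2) (b + 2)) Set.univ := by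
    rintro z ⟨⟨h1, h2⟩, -⟩
    simp only [shiftedPolar] at h1 h2
    have h6 := abs_le.1 ((abs_norm_sub_norm_le z (toC (cellPoint z))).trans
      (norm_sub_cellPoint_le z))
    exact ⟨⟨by linarith, by linarith⟩, trivial⟩
  have h := measureReal_mono hsub (volume_sector_ne_top 1 R bddAbove_Icc)
  rw [volume_real_preimage_cellPoint hfin, volume_real_sector_one (by linarith) (by linarith)
    MeasurableSet.univ, Set.univ_inter, Real.volume_real_Ioo_of_le (by linarith [Real.pi_pos])] at h
  refine h.trans ?_
  have hfac : ((R + (b + 2)) ^ 2 - (R + (a - 2)) ^ 2) / 2 * (Real.pi - -Real.pi) =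
    (b - a + 4) * (2 * Real.pi) * (R + (a + b) / 2) := by ring
  rw [hfac, mul_assoc _ (2 : ℝ) R]
  refine mul_le_mul_of_nonneg_left (by linarith) ?_
  have := Real.pi_pos
  have : 0 ≤ b - a + 4 := by linarith
  positivity

/-! ### Integration over the angle along an ultrafilter -/

theorem exists_tendsto_ultrafilter (U : Ultrafilter ℝ) (hU : (U : Filter ℝ) ≤ atTop) {a b : ℝ}
    (hab : a ≤ b) (J : Set ℝ) :
    ∃ x, Tendsto (fun R => polarCount R (Set.Ioo a b) J / R) U (𝓝 x) := by
  have h := hU (eventually_polarCount_div_mem hab J)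
  obtain ⟨x, -, hx⟩ := isCompact_Icc.ultrafilter_le_nhds
    (U.map fun R => polarCount R (Set.Ioo a b) J / R) (le_principal_iff.2 h)
  exact ⟨x, hx⟩

theorem eq_of_ultrafilter_limit {U : Ultrafilter ℝ} (hU : (U : Filter ℝ) ≤ atTop) {a b : ℝ}
    (hab : a < b) {g : ℝ → ℝ}
    (hg : ∀ t, Tendsto (fun R => polarCount R (Set.Ioo a b) (Set.Ico 0 t) / R) U (𝓝 (g t)))
    {t : ℝ} (ht0 : 0 ≤ t) (ht : t ≤ 2 * Real.pi) : g t = (b - a) * t := by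
  have hpos : ∀ᶠ R : ℝ in U, 0 < R := hU (eventually_gt_atTop 0)
  have hsub : ∀ {r s}, 0 ≤ r → r ≤ s → Tendsto
      (fun R => polarCount R (Set.Ioo a b) (Set.Ico r s) / R) U (𝓝 (g s - g r)) := by
    intro r s hr hrs
    refine ((hg s).sub (hg r)).congr fun R => ?_
    rw [← polarCount_Ico_add R bddAbove_Ioo hr hrs]
    ring
  have hle : ∀ {r s C}, 0 ≤ r → r ≤ s → (∀ᶠ R : ℝ in atTop,
      polarCount R (Set.Ioo a b) (Set.Ico r s) ≤ C * R) → g s - g r ≤ C := by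
    intro r s C hr hrs h
    refine le_of_tendsto (hsub hr hrs) ?_
    filter_upwards [hpos, hU h] with R hR h
    rwa [div_le_iff₀ hR]
  have hge : ∀ {r s C}, 0 ≤ r → r ≤ s → (∀ᶠ R : ℝ in atTop,
      C * R ≤ polarCount R (Set.Ioo a b) (Set.Ico r s)) → C ≤ g s - g r := by
    intro r s C hr hrs h
    refine ge_of_tendsto (hsub hr hrs) ?_
    filter_upwards [hpos, hU h] with R hR h
    rwa [le_div_iff₀ hR]
  have hlip : ∀ {r s}, 0 ≤ r → r ≤ s → s ≤ r + 1 → s ≤ 2 * Real.pi →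
      |g s - g r| ≤ (b - a + 5) * (s - r) := by
    intro r s hr hrs hs1 hs
    rcases hrs.eq_or_lt with rfl | hrs'
    · simp
    rw [abs_of_nonneg]
    · exact hle hr hrs (eventually_polarCount_le hab hr hrs' hs1 hs)
    · refine hge hr hrs ?_
      filter_upwards with R
      rw [zero_mul]
      exact Nat.cast_nonneg _
  have hg0 : g 0 = 0 := by
    refine tendsto_nhds_unique (hg 0) ?_
    simp [polarCount]
  have hC : 0 < b - a + 5 := by linarith
  have hcont : ContinuousOn g (Set.Icc 0 t) := by
    rw [Metric.continuousOn_iff]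
    intro x hx ε hε
    refine ⟨min 1 (ε / (b - a + 5)), lt_min one_pos (by positivity), fun y hy hxy => ?_⟩
    rw [Real.dist_eq] at hxy ⊢
    have h1 := hxy.trans_le (min_le_left _ _)
    have h2 := (lt_div_iff₀ hC).1 (hxy.trans_le (min_le_right _ _))
    refine lt_of_le_of_lt ?_ h2
    rw [mul_comm]
    rcases le_total x y with h | h
    · rw [abs_of_nonneg (sub_nonneg.2 h)] at h1 ⊢
      exact hlip hx.1 h (by linarith) (by linarith [hy.2])
    · rw [abs_sub_comm y] at h1 ⊢
      rw [abs_of_nonneg (sub_nonneg.2 h)] at h1 ⊢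
      rw [abs_sub_comm]
      exact hlip hy.1 h (by linarith) (by linarith [hx.2])
  have hderiv : ∀ x ∈ Set.Ioo 0 t \ {θ : ℝ | ¬ Irrational (Real.cos θ / Real.sin θ)},
      HasDerivAt g (b - a) x := by
    rintro x ⟨⟨hx0, hxt⟩, hx⟩
    have hd := denseProjections_of_irrational (not_not.1 hx)
    have hu := norm_exp_neg_mul_I x
    rw [hasDerivAt_iff_isLittleO, Asymptotics.isLittleO_iff]
    intro ε hε
    obtain ⟨δ₁, hδ₁, H₁⟩ := exists_eventually_sectorCount_le hu hd hab hε
    obtain ⟨δ₂, hδ₂, H₂⟩ := exists_eventually_le_sectorCount hu hd hab hε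
    have key : ∀ {r s}, 0 ≤ r → r < s → s ≤ 2 * Real.pi → |r - x| ≤ 1 → |s - x| ≤ 1 →
        |r - x| ≤ δ₁ → |s - x| ≤ δ₁ → |r - x| ≤ δ₂ → |s - x| ≤ δ₂ →
        |g s - g r - (s - r) * (b - a)| ≤ ε * (s - r) := by
      intro r s hr hrs hs h1 h2 h3 h4 h5 h6
      have e : s - x - (r - x) = s - r := by ring
      have hcount : ∀ᶠ R : ℝ in atTop, polarCount R (Set.Ioo a b) (Set.Ico r s) =
          sectorCount (Complex.exp (-x * Complex.I)) R (Set.Ioo a b)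
            (Set.Ico (r - x) (s - x)) := by
        filter_upwards [eventually_gt_atTop (-a)] with R hR
        exact polarCount_eq_sectorCount (fun y hy => by linarith [hy.1]) hr hs h1 h2
      have hA := hle (C := (b - a + ε) * (s - r)) hr hrs.le (by
        filter_upwards [hcount, H₁ (r - x) (s - x) (abs_le.1 h3).1 (by linarith)
          (abs_le.1 h4).2] with R e1 e2
        rwa [e1, ← e])
      have hB := hge (C := (b - a - ε) * (s - r)) hr hrs.le (by
        filter_upwards [hcount, H₂ (r - x) (s - x) (abs_le.1 h5).1 (by linarith)
          (abs_le.1 h6).2] with R e1 e2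
        rwa [e1, ← e])
      rw [abs_le]
      constructor <;> nlinarith
    have hev : ∀ {δ : ℝ}, 0 < δ → ∀ᶠ y in 𝓝 x, |y - x| ≤ δ := fun {δ} hδ => by
      filter_upwards [Metric.closedBall_mem_nhds x hδ] with y hy
      simpa [Real.dist_eq] using hy
    filter_upwards [hev one_pos, hev hδ₁, hev hδ₂, eventually_gt_nhds hx0,
      eventually_lt_nhds hxt] with y h1 h2 h3 h4 h5
    rw [Real.norm_eq_abs, Real.norm_eq_abs, smul_eq_mul]
    rcases lt_trichotomy x y with h | rfl | h
    · rw [abs_of_pos (sub_pos.2 h)]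
      exact key hx0.le h (by linarith) (by simp) h1 (by simpa using hδ₁.le) h2
        (by simpa using hδ₂.le) h3
    · simp
    · rw [abs_of_neg (sub_neg.2 h), ← abs_neg]
      have := key h4.le h (by linarith) h1 (by simp) h2 (by simpa using hδ₁.le) h3
        (by simpa using hδ₂.le)
      convert this using 2 <;> ring
  -- The fundamental theorem of calculus tolerates a countable exceptional set because `g` is
  -- continuous.
  have h := integral_eq_of_hasDerivAt_off_countable_of_le g (fun _ => b - a) ht0
    countable_rational_slopes hcont hderiv intervalIntegrable_const
  rw [intervalIntegral.integral_const, hg0, sub_zero, sub_zero, smul_eq_mul] at h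
  rw [← h, mul_comm]

theorem tendsto_polarCount_div {a b s t : ℝ} (hab : a < b) (hs : 0 ≤ s) (hst : s ≤ t)
    (ht : t ≤ 2 * Real.pi) :
    Tendsto (fun R => polarCount R (Set.Ioo a b) (Set.Ico s t) / R) atTop
      (𝓝 ((b - a) * (t - s))) := by
  rw [tendsto_iff_ultrafilter]
  intro U hU
  choose g hg using fun t => exists_tendsto_ultrafilter U hU hab.le (Set.Ico 0 t)
  have h1 := eq_of_ultrafilter_limit hU hab hg hs (hst.trans ht)
  have h2 := eq_of_ultrafilter_limit hU hab hg (hs.trans hst) ht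
  rw [mul_sub, ← h1, ← h2]
  refine ((hg t).sub (hg s)).congr fun R => ?_
  rw [← polarCount_Ico_add R bddAbove_Ioo hs hst]
  ring

/-! ### Convergence of the laws -/

theorem uniformOn_real_preimage (R : ℝ) (a b s t : ℝ) :
    (uniformOn (annulusPoints R)).real (shiftedPolar R ⁻¹' (Set.Ioo a b ×ˢ Set.Ico s t)) =
      polarCount R (Set.Ioo (max (-(1 / √2)) a) (min (1 / √2) b))
        (Set.Ico (max 0 s) (min (2 * Real.pi) t)) /
      polarCount R (Set.Ioo (-(1 / √2)) (1 / √2)) (Set.Ico 0 (2 * Real.pi)) := by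
  have h1 : annulusPoints R =
      shiftedPolar R ⁻¹' (Set.Ioo (-(1 / √2)) (1 / √2) ×ˢ Set.Ico 0 (2 * Real.pi)) := by
    ext p
    refine ⟨fun h => ⟨⟨?_, ?_⟩, (shiftedPolar_mem h).2⟩, fun h => ⟨?_, ?_⟩⟩
    · simp only [shiftedPolar]; linarith [h.1]
    · simp only [shiftedPolar]; linarith [h.2]
    · have := h.1.1; simp only [shiftedPolar] at this; linarith
    · have := h.1.2; simp only [shiftedPolar] at this; linarith
  have h2 : annulusPoints R ∩ shiftedPolar R ⁻¹' (Set.Ioo a b ×ˢ Set.Ico s t) =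
      shiftedPolar R ⁻¹' (Set.Ioo (max (-(1 / √2)) a) (min (1 / √2) b) ×ˢ
        Set.Ico (max 0 s) (min (2 * Real.pi) t)) := by
    rw [h1, ← Set.preimage_inter, Set.prod_inter_prod, Set.Ioo_inter_Ioo, Set.Ico_inter_Ico]
  have hcount : ∀ P : Set (ℤ × ℤ), P.Finite → Measure.count.real P = P.ncard := by
    intro P hP
    rw [measureReal_def, Measure.count_apply_finite _ hP, Set.ncard_eq_toFinset_card P hP]
    simp
  have hfin := annulusPoints_finite R
  rw [uniformOn, measureReal_def, cond_apply hfin.measurableSet, ENNReal.toReal_mul,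
    ENNReal.toReal_inv, ← measureReal_def, ← measureReal_def, h2, hcount _ hfin,
    hcount _ (finite_preimage_shiftedPolar R bddAbove_Ioo)]
  conv_lhs => rw [h1]
  rw [inv_mul_eq_div]
  rfl

theorem unifG_real_prod (a b s t : ℝ) :
    unifG.real (Set.Ioo a b ×ˢ Set.Ico s t) =
      volume.real (Set.Ioo (max (-(1 / √2)) a) (min (1 / √2) b)) *
        volume.real (Set.Ico (max 0 s) (min (2 * Real.pi) t)) /
      ((1 / √2 - -(1 / √2)) * (2 * Real.pi - 0)) := by
  have hsq : 0 < 1 / √2 := by positivity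
  have hG : volume.real rectG = (1 / √2 - -(1 / √2)) * (2 * Real.pi - 0) := by
    rw [rectG, Measure.volume_eq_prod, measureReal_prod_prod,
      Real.volume_real_Icc_of_le (by linarith), Real.volume_real_Ico_of_le Real.two_pi_pos.le]
  have hI : volume.real (Set.Icc (-(1 / √2)) (1 / √2) ∩ Set.Ioo a b) =
      volume.real (Set.Ioo (max (-(1 / √2)) a) (min (1 / √2) b)) := by
    rw [← Set.Ioo_inter_Ioo]
    exact measureReal_congr (Ioo_ae_eq_Icc.symm.inter (ae_eq_refl _))
  rw [unifG_eq_cond, measureReal_def,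
    cond_apply (show MeasurableSet rectG from measurableSet_Icc.prod measurableSet_Ico),
    ENNReal.toReal_mul, ENNReal.toReal_inv, ← measureReal_def, ← measureReal_def, hG, rectG,
    Set.prod_inter_prod, Measure.volume_eq_prod, measureReal_prod_prod, hI, Set.Ico_inter_Ico,
    inv_mul_eq_div]

theorem tendsto_uniformOn_real_preimage (a b s t : ℝ) :
    Tendsto (fun R => (uniformOn (annulusPoints R)).real
      (shiftedPolar R ⁻¹' (Set.Ioo a b ×ˢ Set.Ico s t))) atTop
      (𝓝 (unifG.real (Set.Ioo a b ×ˢ Set.Ico s t))) := by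
  have hpi := Real.two_pi_pos
  have hsq : 0 < 1 / √2 := by positivity
  simp_rw [uniformOn_real_preimage, unifG_real_prod]
  have hden := tendsto_polarCount_div (a := -(1 / √2)) (b := 1 / √2) (by linarith) le_rfl
    hpi.le le_rfl
  have hnum : Tendsto (fun R => polarCount R (Set.Ioo (max (-(1 / √2)) a) (min (1 / √2) b))
      (Set.Ico (max 0 s) (min (2 * Real.pi) t)) / R) atTop
      (𝓝 (volume.real (Set.Ioo (max (-(1 / √2)) a) (min (1 / √2) b)) *
        volume.real (Set.Ico (max 0 s) (min (2 * Real.pi) t)))) := by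
    rcases lt_or_ge (max (-(1 / √2)) a) (min (1 / √2) b) with h1 | h1
    · rcases le_total (max 0 s) (min (2 * Real.pi) t) with h2 | h2
      · rw [Real.volume_real_Ioo_of_le h1.le, Real.volume_real_Ico_of_le h2]
        exact tendsto_polarCount_div h1 (le_max_left _ _) h2 (min_le_left _ _)
      · rw [Set.Ico_eq_empty_of_le h2]
        simp [polarCount]
    · rw [Set.Ioo_eq_empty_of_le h1]
      simp [polarCount]
  refine (hnum.div hden (mul_pos (by linarith) (by linarith)).ne').congr' ?_
  filter_upwards [eventually_ne_atTop 0] with R hR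
  exact div_div_div_cancel_right₀ hR _ _

theorem isPiSystem_Ioo_prod_Ico :
    IsPiSystem {S : Set (ℝ × ℝ) | ∃ a b s t : ℝ, S = Set.Ioo a b ×ˢ Set.Ico s t} := by
  rintro _ ⟨a, b, s, t, rfl⟩ _ ⟨a', b', s', t', rfl⟩ -
  refine ⟨max a a', min b b', max s s', min t t', ?_⟩
  rw [Set.prod_inter_prod, Set.Ioo_inter_Ioo, Set.Ico_inter_Ico]

end CircleLattice

theorem mainTheorem11 :
    TendstoInDistribution
      (fun (R : {R : ℝ // 0 < R}) (p : ℤ × ℤ) => CircleLattice.shiftedPolar R p)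
      (comap (fun R : {R : ℝ // 0 < R} => (R : ℝ)) atTop)
      (id : ℝ × ℝ → ℝ × ℝ)
      (fun R : {R : ℝ // 0 < R} => uniformOn (CircleLattice.annulusPoints R))
      CircleLattice.unifG := by
  have hmeas : ∀ R : ℝ, Measurable (CircleLattice.shiftedPolar R) := fun R =>
    measurable_of_countable _
  refine ⟨fun R => (hmeas R).aemeasurable, aemeasurable_id, ?_⟩
  refine CircleLattice.isPiSystem_Ioo_prod_Ico.tendsto_probabilityMeasure_of_tendsto_of_mem
    ?_ ?_ ?_
  · rintro _ ⟨a, b, s, t, rfl⟩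
    exact measurableSet_Ioo.prod measurableSet_Ico
  · rintro u hu ⟨x, y⟩ hxy
    obtain ⟨ε, hε, hball⟩ := Metric.isOpen_iff.1 hu _ hxy
    -- The half-open side contains its left endpoint, so `ε / 2` keeps it inside the open ball.
    refine ⟨Set.Ioo (x - ε) (x + ε) ×ˢ Set.Ico (y - ε / 2) (y + ε / 2), ⟨_, _, _, _, rfl⟩,
      prod_mem_nhds (Ioo_mem_nhds (by linarith) (by linarith))
        (Ico_mem_nhds (by linarith) (by linarith)), ?_⟩
    refine Set.Subset.trans ?_ hball
    rintro ⟨p, q⟩ ⟨⟨h1, h2⟩, h3, h4⟩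
    rw [Metric.mem_ball, Prod.dist_eq, max_lt_iff, Real.dist_eq, Real.dist_eq, abs_lt, abs_lt]
    exact ⟨⟨by linarith, by linarith⟩, by linarith, by linarith⟩
  · rintro _ ⟨a, b, s, t, rfl⟩
    rw [← NNReal.tendsto_coe]
    have h := (CircleLattice.tendsto_uniformOn_real_preimage a b s t).comp
      (tendsto_comap (f := fun R : {R : ℝ // 0 < R} => (R : ℝ)))
    convert! h using 2
    · rename_i R
      change (Measure.map (CircleLattice.shiftedPolar R) _ _).toReal = _
      rw [Measure.map_apply (hmeas R) (measurableSet_Ioo.prod measurableSet_Ico)]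
      rfl
    · change (Measure.map id CircleLattice.unifG _).toReal = _
      rw [Measure.map_id]
      rfl
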